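/- Let $(X_k)_{k\ge 0}$ be a birth-and-death Markov chain on $\{0,1,2,\dots\}$, with an arbitrary initial distribution, that moves from $i$ to $i+1$ with probability $p_i$ and from $i$ to $i-1$ with probability $q_i$, where $p_0=1$, $q_0=0$, and $p_i,q_i>0$, $p_i+q_i=1$ for $i\ge 1$. For every $i\ge 0$ let $\tau_i^+$ and $\tau_i^-$ be positive random variables with arbitrary distributions, and let $\{\tau_{i,k}^+\}_{k\ge 0}$ and $\{\tau_{i,k}^-\}_{k\ge 0}$ be sequences of independent copies of them; all these sequences and the chain $(X_k)$ are independent of each other. Put $T_0=0$ and $T_{k+1}=T_k+\tau^k$, where, if $X_k=i$, $\tau^k=\tau_{i,k}^+$ when $X_{k+1}=i+1$ and $\tau^k=\tau_{i,k}^-$ when $X_{k+1}=i-1$. The continuous-time random walk $X$ is given by $X(t)=X_k$ for $t\in[T_k,T_{k+1})$, $k\ge 0$. Let $\sigma_n=\inf\{t\ge 0: X(t)=n\}$ (with $\inf\varnothing=\infty$); $X$ is said to explode to $\infty$ if $\sigma_\infty=\lim_{n\to\infty}\sigma_n<\infty$. For $k,i\ge 0$ put $$\delta_k=\frac{q_1\cdots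 q_k}{p_1\cdots p_k},\qquad \nu_i=\bigl(1-\mathsf E e^{-\tau_i}\bigr)\frac{p_1\cdots p_{i-1}}{q_1\cdots q_i},\qquad \mathsf E e^{-\tau_i}=p_i\,\mathsf E e^{-\tau_i^+}+q_i\,\mathsf E e^{-\tau_i^-},$$ where empty products are equal to $1$ (so $\delta_0=1$ and $\nu_0=1-\mathsf E e^{-\tau_0^+}$). **Theorem 1 (Explosion condition).** For every initial distribution of $X$, the following alternative holds: $$\mathsf P\{X\text{ explodes to }\infty\}=1\iff \sum_{k=0}^\infty\Bigl(\sum_{i=0}^k\nu_i\Bigr)\delta_k<\infty,$$ $$\mathsf P\{X\text{ explodes to }\infty\}=0\iff \sum_{k=0}^\infty\Bigl(\sum_{i=0}^k\nu_i\Bigr)\delta_k=\infty.$$ In particular, the probability of explosion is either $0$ or $1$. -/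

import Mathlib

open MeasureTheory ProbabilityTheory Filter Topology
open scoped NNReal ENNReal

namespace CTRW

/-! ### Trajectories

A trajectory is determined by a path `x` of the embedded chain and an array `w` of waiting times:
`w true i k` is the right waiting time `τ⁺_{i,k}` and `w false i k` is the left one `τ⁻_{i,k}`. -/

/-- The time `τ^k` spent at `x k` before the `(k+1)`-st jump: the `k`-th copy of the right (left)
waiting time at the current state if the jump is to the right (left). -/
def wait (x : ℕ → ℕ) (w : Bool → ℕ → ℕ → ℝ) (k : ℕ) : ℝ :=
  if x (k + 1) = x k + 1 then w true (x k) k else w false (x k) k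

/-- The moments of jumps, `T 0 = 0` and `T (k + 1) = T k + τ^k`. -/
def jumpTime (x : ℕ → ℕ) (w : Bool → ℕ → ℕ → ℝ) : ℕ → ℝ
  | 0 => 0
  | k + 1 => jumpTime x w k + wait x w k

open Classical in
/-- The continuous-time random walk at time `t`: it equals `x k` for `t ∈ [T k, T (k + 1))`, and has
no value (`none`) at a time `t` that no such interval contains. -/
noncomputable def walk (x : ℕ → ℕ) (w : Bool → ℕ → ℕ → ℝ) (t : ℝ) : Option ℕ :=
  if h : ∃ k, t ∈ Set.Ico (jumpTime x w k) (jumpTime x w (k + 1)) then some (x (Nat.find h))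
  else none

/-- `σ_n = inf {t ≥ 0 | X(t) = n}`, equal to `∞` if the walk never visits `n`. -/
noncomputable def hitTime (x : ℕ → ℕ) (w : Bool → ℕ → ℕ → ℝ) (n : ℕ) : ℝ≥0∞ :=
  ⨅ (t : ℝ≥0) (_ : walk x w t = some n), (t : ℝ≥0∞)

/-- The walk explodes to `∞`: the moment of explosion `σ_∞ = lim σ_n` is finite. -/
def Explodes (x : ℕ → ℕ) (w : Bool → ℕ → ℕ → ℝ) : Prop :=
  ∃ s : ℝ≥0∞, Tendsto (fun n => hitTime x w n) atTop (𝓝 s) ∧ s < ∞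

/-! ### The random walk -/

/-- One-step transition probabilities of the birth-and-death chain. -/
def transProb (p q : ℕ → ℝ) (i j : ℕ) : ℝ :=
  if j = i + 1 then p i else if j + 1 = i then q i else 0

/-- `(X k)` is a Markov chain on `ℕ` with initial distribution `ρ` and birth and death
probabilities `p`, `q`. -/
structure IsBirthDeathChain {Ω : Type*} [MeasurableSpace Ω] (P : Measure Ω) (p q : ℕ → ℝ)
    (ρ : Measure ℕ) (X : ℕ → Ω → ℕ) : Prop where
  measurable : ∀ k, Measurable (X k)
  initial : P.map (X 0) = ρ
  markov : ∀ (k : ℕ) (x : ℕ → ℕ),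
    P.real {ω | ∀ m ≤ k + 1, X m ω = x m} =
      P.real {ω | ∀ m ≤ k, X m ω = x m} * transProb p q (x k) (x (k + 1))

/-- The data of a continuous-time random walk: an embedded birth-and-death chain `X`, together with
waiting times `τ s i k` (`s = true` right, `s = false` left) of law `F s i`, such that all the
waiting times are mutually independent and jointly independent of the chain. -/
structure IsRandomWalk {Ω : Type*} [MeasurableSpace Ω] (P : Measure Ω) (p q : ℕ → ℝ)
    (F : Bool → ℕ → Measure ℝ) (ρ : Measure ℕ) (X : ℕ → Ω → ℕ) (τ : Bool → ℕ → ℕ → Ω → ℝ) :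
    Prop where
  chain : IsBirthDeathChain P p q ρ X
  measurable : ∀ s i k, Measurable (τ s i k)
  law : ∀ s i k, P.map (τ s i k) = F s i
  indep : iIndepFun (fun (j : Bool × ℕ × ℕ) => τ j.1 j.2.1 j.2.2) P
  indep_chain : IndepFun (fun ω k => X k ω) (fun ω (j : Bool × ℕ × ℕ) => τ j.1 j.2.1 j.2.2 ω) P

/-! ### Scale and speed measure -/

/-- The scale `δ_k = (q_1 ⋯ q_k) / (p_1 ⋯ p_k)`. -/
noncomputable def scale (p q : ℕ → ℝ) (k : ℕ) : ℝ :=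
  (∏ m ∈ Finset.Icc 1 k, q m) / ∏ m ∈ Finset.Icc 1 k, p m

/-- `E e^{-τ_i} = p_i E e^{-τ_i⁺} + q_i E e^{-τ_i⁻}`. -/
noncomputable def laplace (p q : ℕ → ℝ) (F : Bool → ℕ → Measure ℝ) (i : ℕ) : ℝ :=
  p i * ∫ y, Real.exp (-y) ∂(F true i) + q i * ∫ y, Real.exp (-y) ∂(F false i)

/-- The speed measure `ν_i = (1 - E e^{-τ_i}) (p_1 ⋯ p_{i-1}) / (q_1 ⋯ q_i)`. -/
noncomputable def speed (p q : ℕ → ℝ) (F : Bool → ℕ → Measure ℝ) (i : ℕ) : ℝ :=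
  (1 - laplace p q F i) * ((∏ m ∈ Finset.Ico 1 i, p m) / ∏ m ∈ Finset.Icc 1 i, q m)

/-- The value in `[0, ∞]` of the series `∑_k (∑_{i ≤ k} ν_i) δ_k`, whose terms are nonnegative. -/
noncomputable def explosionSeries (p q : ℕ → ℝ) (F : Bool → ℕ → Measure ℝ) : ℝ≥0∞ :=
  ∑' k : ℕ, ENNReal.ofReal ((∑ i ∈ Finset.range (k + 1), speed p q F i) * scale p q k)

end CTRW

/-!
Let `h i = 1 - E e^{-τ_i}` and let `W i = ∑_{k < i} (∑_{j ≤ k} ν_j) δ_k` be the partial sums of the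
explosion series. The scale `δ` and the speed measure `ν` are made so that `W` solves the Poisson
equation `p_i W (i + 1) + q_i W (i - 1) - W i = h i` (`potential_step`). Both alternatives follow
from a Lyapunov estimate (`sum_lintegral_discount_le`) for a function built from `W`, and neither
needs to know whether the chain is recurrent or transient.

If the series has a finite sum `S`, then `S - W` takes values in `[0, S]` and has drift `-h`, so
`∑_k E h (X_k) ≤ S` whatever the initial law is. As `h > 0`, almost surely each state is visited
finitely often, so `X_k → ∞`. As `E (1 - e^{-τ^k}) = E h (X_k)`, almost surely
`∑_k (1 - e^{-τ^k}) < ∞`, so `∑_k τ^k < ∞`, and the walk explodes (`ae_explodes`).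

If the series diverges, let `Π_k` be the conditional mean of `e^{-T_k}` given the chain, a product
of Laplace transforms of waiting times. The function `u = 2 + W` tends to infinity, and under the
discounted dynamics its drift is at most `-h` (`potential_add_two_step`): passing from `W` to its
discounted mean gains `h`, while discounting `2 + W ≥ 2` loses at least `2 h`. Hence, for the chain
started at `m`, both `∑_k E Π_k h (X_k)` and `E Π_n u (X_n)` are at most `u m`. On the event that
`Π_k` has a positive limit, the first bound forces `X_k → ∞` almost surely, and then the second one
is violated by Fatou's lemma. So `Π_k → 0` almost surely (`ae_tendsto_discount_zero`), whence
`E e^{-T_k} → 0`, so `T_k → ∞` almost surely and there is no explosion (`ae_not_explodes`).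

In both cases the explosion event agrees with `∅` or the whole space up to a null set, which also
yields its null-measurability.
-/

namespace CTRW

/-! ### Explosion of a single trajectory -/

lemma wait_eq (x : ℕ → ℕ) (w : Bool → ℕ → ℕ → ℝ) (k : ℕ) :
    wait x w k = w (decide (x (k + 1) = x k + 1)) (x k) k := by
  unfold wait
  split_ifs with h <;> simp [h]

lemma jumpTime_eq_sum (x : ℕ → ℕ) (w : Bool → ℕ → ℕ → ℝ) (k : ℕ) :
    jumpTime x w k = ∑ j ∈ Finset.range k, wait x w j := by
  induction k with
  | zero => simp [jumpTime]
  | succ k ih => rw [jumpTime, ih, Finset.sum_range_succ]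

section Trajectory

variable {x : ℕ → ℕ} {w : Bool → ℕ → ℕ → ℝ}

lemma strictMono_jumpTime (hw : ∀ s i k, 0 < w s i k) : StrictMono (jumpTime x w) :=
  strictMono_nat_of_lt_succ fun k => by
    rw [jumpTime, wait_eq]
    linarith [hw (decide (x (k + 1) = x k + 1)) (x k) k]

lemma jumpTime_nonneg (hw : ∀ s i k, 0 < w s i k) (k : ℕ) : 0 ≤ jumpTime x w k :=
  (strictMono_jumpTime (x := x) hw).monotone (Nat.zero_le k)

lemma walk_jumpTime (hw : ∀ s i k, 0 < w s i k) (k : ℕ) :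
    walk x w (jumpTime x w k) = some (x k) := by
  have hT := strictMono_jumpTime (x := x) hw
  have h : ∃ j, jumpTime x w k ∈ Set.Ico (jumpTime x w j) (jumpTime x w (j + 1)) :=
    ⟨k, le_rfl, hT (Nat.lt_succ_self k)⟩
  classical
  have hk : Nat.find h = k := by
    obtain ⟨h1, h2⟩ := Nat.find_spec h
    have h3 := hT.le_iff_le.1 h1
    have h4 := hT.lt_iff_lt.1 h2
    omega
  rw [walk, dif_pos h]
  convert congrArg (fun j => some (x j)) hk

lemma exists_of_walk_eq_some {t : ℝ} {n : ℕ} (h : walk x w t = some n) :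
    ∃ k, x k = n ∧ jumpTime x w k ≤ t := by
  classical
  unfold walk at h
  split_ifs at h with h'
  exact ⟨_, Option.some_injective _ h, (Nat.find_spec h').1⟩

lemma hitTime_le_jumpTime (hw : ∀ s i k, 0 < w s i k) (k : ℕ) :
    hitTime x w (x k) ≤ ENNReal.ofReal (jumpTime x w k) := by
  refine iInf₂_le (Real.toNNReal (jumpTime x w k)) ?_
  rw [Real.coe_toNNReal _ (jumpTime_nonneg hw k)]
  exact walk_jumpTime hw k

/-- A level not visited by the first `K + 1` states is reached only after the `K`-th jump. -/
lemma jumpTime_le_hitTime (hw : ∀ s i k, 0 < w s i k) {K n : ℕ} (h : ∀ k ≤ K, x k ≠ n) :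
    ENNReal.ofReal (jumpTime x w K) ≤ hitTime x w n := by
  refine le_iInf₂ fun t ht => ?_
  obtain ⟨k, hk, hkt⟩ := exists_of_walk_eq_some ht
  have hKk : K ≤ k := by
    by_contra hlt
    exact h k (by omega) hk
  exact ENNReal.ofReal_le_of_le_toReal
    (((strictMono_jumpTime hw).monotone hKk).trans hkt)

lemma eventually_ofReal_jumpTime_le_hitTime (hw : ∀ s i k, 0 < w s i k) (K : ℕ) :
    ∀ᶠ n in atTop, ENNReal.ofReal (jumpTime x w K) ≤ hitTime x w n := by
  filter_upwards [eventually_gt_atTop (∑ k ∈ Finset.range (K + 1), x k)] with n hn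
  refine jumpTime_le_hitTime hw fun k hk => ?_
  have := Finset.single_le_sum (f := x) (fun i _ => Nat.zero_le _)
    (Finset.mem_range.2 (show k < K + 1 by omega))
  omega

lemma not_explodes_of_tendsto (hw : ∀ s i k, 0 < w s i k)
    (hT : Tendsto (jumpTime x w) atTop atTop) : ¬ Explodes x w := by
  rintro ⟨s, hs, hlt⟩
  obtain ⟨K, hK⟩ := (hT.eventually_gt_atTop s.toReal).exists
  have h1 := ge_of_tendsto hs (eventually_ofReal_jumpTime_le_hitTime hw K)
  have h2 := (ENNReal.ofReal_le_iff_le_toReal hlt.ne).1 h1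
  linarith

/-- A path with unit steps visits every level between its start and any later position. -/
lemma exists_eq_of_le (hx : ∀ k, x (k + 1) = x k + 1 ∨ x (k + 1) + 1 = x k) {n : ℕ}
    (h0 : x 0 ≤ n) (k : ℕ) (hk : n ≤ x k) : ∃ j, x j = n := by
  induction k with
  | zero => exact ⟨0, le_antisymm h0 hk⟩
  | succ k ih =>
    by_cases h : n ≤ x k
    · exact ih h
    · exact ⟨k + 1, by rcases hx k with h' | h' <;> omega⟩

lemma explodes_of_summable (hw : ∀ s i k, 0 < w s i k)
    (hx : ∀ k, x (k + 1) = x k + 1 ∨ x (k + 1) + 1 = x k) (hxt : Tendsto x atTop atTop)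
    (hs : Summable (wait x w)) : Explodes x w := by
  have hnn : ∀ k, 0 ≤ wait x w k := fun k => by
    rw [wait_eq]
    exact (hw _ _ _).le
  have hT : Tendsto (jumpTime x w) atTop (𝓝 (∑' k, wait x w k)) := by
    simpa [funext (jumpTime_eq_sum x w)] using hs.hasSum.tendsto_sum_nat
  have hle : ∀ k, jumpTime x w k ≤ ∑' k, wait x w k := fun k => by
    rw [jumpTime_eq_sum]
    exact hs.sum_le_tsum _ fun j _ => hnn j
  refine ⟨ENNReal.ofReal (∑' k, wait x w k), tendsto_order.2 ⟨fun a ha => ?_, fun a ha => ?_⟩,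
    ENNReal.ofReal_lt_top⟩
  · obtain ⟨K, hK⟩ := ((ENNReal.tendsto_ofReal hT).eventually_const_lt ha).exists
    exact (eventually_ofReal_jumpTime_le_hitTime hw K).mono fun n hn => hK.trans_le hn
  · filter_upwards [eventually_ge_atTop (x 0)] with n hn
    obtain ⟨k, hk⟩ := (hxt.eventually_ge_atTop n).exists
    obtain ⟨j, rfl⟩ := exists_eq_of_le hx hn k hk
    exact ((hitTime_le_jumpTime hw j).trans (ENNReal.ofReal_le_ofReal (hle j))).trans_lt ha

end Trajectory

/-- Since `1 - e^{-t}` is comparable to `t` for small `t`, the series `∑ tₖ` converges as soon as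
`∑ (1 - e^{-tₖ})` does. -/
lemma summable_of_tsum_one_sub_exp_ne_top {t : ℕ → ℝ} (ht : ∀ k, 0 ≤ t k)
    (h : ∑' k, ENNReal.ofReal (1 - Real.exp (-t k)) ≠ ∞) : Summable t := by
  have hnn : ∀ k, 0 ≤ 1 - Real.exp (-t k) := fun k =>
    sub_nonneg.2 (Real.exp_le_one_iff.2 (neg_nonpos.2 (ht k)))
  have hs : Summable fun k => 1 - Real.exp (-t k) := by
    simpa [ENNReal.toReal_ofReal (hnn _)] using ENNReal.summable_toReal h
  have hev := hs.tendsto_atTop_zero.eventually_lt_const (show (0 : ℝ) < 1 / 2 by norm_num)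
  refine Summable.of_norm_bounded_eventually_nat (hs.mul_left 2) (hev.mono fun k hk => ?_)
  rw [Real.norm_of_nonneg (ht k)]
  -- `e^t ≥ 1 + t` gives `1 - e^{-t} ≥ t e^{-t}`, and eventually `e^{-t} > 1 / 2`
  have h1 : (t k + 1) * Real.exp (-t k) ≤ 1 := by
    calc (t k + 1) * Real.exp (-t k) ≤ Real.exp (t k) * Real.exp (-t k) := by
          gcongr
          exact Real.add_one_le_exp _
      _ = 1 := by rw [← Real.exp_add]; simp
  nlinarith [ht k]

/-! ### The potential of the birth-and-death chain -/

/-- The Laplace transform at `1` of the waiting time of law `F s i`. -/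
noncomputable def waitLaplace (F : Bool → ℕ → Measure ℝ) (s : Bool) (i : ℕ) : ℝ :=
  ∫ y, Real.exp (-y) ∂(F s i)

/-- The `k`-th term `(∑_{i ≤ k} ν_i) δ_k` of the explosion series. -/
noncomputable def seriesTerm (p q : ℕ → ℝ) (F : Bool → ℕ → Measure ℝ) (k : ℕ) : ℝ :=
  (∑ i ∈ Finset.range (k + 1), speed p q F i) * scale p q k

/-- The partial sum `W i = ∑_{k < i} (∑_{j ≤ k} ν_j) δ_k` of the explosion series, as a function on
the state space. -/
noncomputable def potential (p q : ℕ → ℝ) (F : Bool → ℕ → Measure ℝ) (i : ℕ) : ℝ :=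
  ∑ k ∈ Finset.range i, seriesTerm p q F k

section Potential

variable {p q : ℕ → ℝ} {F : Bool → ℕ → Measure ℝ}

lemma laplace_eq (i : ℕ) :
    laplace p q F i = p i * waitLaplace F true i + q i * waitLaplace F false i := rfl

/-- The potential solves the Poisson equation `π W - W = 1 - E e^{-τ}` for the transition operator
`π` of the chain. -/
lemma potential_step (hp0 : p 0 = 1) (hpq : ∀ i, p i + q i = 1)
    (hpos : ∀ i, 1 ≤ i → 0 < p i ∧ 0 < q i) (i : ℕ) :
    p i * potential p q F (i + 1) + q i * potential p q F (i - 1) - potential p q F i =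
      1 - laplace p q F i := by
  cases i with
  | zero =>
    have hq0 : q 0 = 0 := by linarith [hpq 0]
    simp [potential, seriesTerm, scale, speed, hp0, hq0]
  | succ n =>
    have hp : p (n + 1) ≠ 0 := (hpos _ (by omega)).1.ne'
    have hq : q (n + 1) ≠ 0 := (hpos _ (by omega)).2.ne'
    have hP : ∏ m ∈ Finset.Icc 1 n, p m ≠ 0 :=
      Finset.prod_ne_zero_iff.2 fun m hm => (hpos m (Finset.mem_Icc.1 hm).1).1.ne'
    have hQ : ∏ m ∈ Finset.Icc 1 n, q m ≠ 0 :=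
      Finset.prod_ne_zero_iff.2 fun m hm => (hpos m (Finset.mem_Icc.1 hm).1).2.ne'
    have hsc : p (n + 1) * scale p q (n + 1) = q (n + 1) * scale p q n := by
      simp only [scale, Finset.prod_Icc_succ_top (Nat.le_add_left 1 n)]
      field_simp
    have hsp : q (n + 1) * scale p q n * speed p q F (n + 1) = 1 - laplace p q F (n + 1) := by
      have hI : Finset.Ico 1 (n + 1) = Finset.Icc 1 n := by ext; simp
      simp only [scale, speed, Finset.prod_Icc_succ_top (Nat.le_add_left 1 n), hI]
      field_simp
    have h1 : potential p q F (n + 1) = potential p q F n + seriesTerm p q F n :=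
      Finset.sum_range_succ _ _
    have h2 : potential p q F (n + 1 + 1) = potential p q F (n + 1) + seriesTerm p q F (n + 1) :=
      Finset.sum_range_succ _ _
    have h3 : seriesTerm p q F (n + 1) =
        (∑ i ∈ Finset.range (n + 1), speed p q F i + speed p q F (n + 1)) * scale p q (n + 1) := by
      rw [seriesTerm, Finset.sum_range_succ]
    have h4 : p (n + 1) * seriesTerm p q F (n + 1) =
        q (n + 1) * seriesTerm p q F n + (1 - laplace p q F (n + 1)) := by
      rw [h3, ← hsp, seriesTerm]
      linear_combination
        (∑ i ∈ Finset.range (n + 1), speed p q F i + speed p q F (n + 1)) * hsc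
    rw [Nat.add_sub_cancel]
    linear_combination p (n + 1) * h2 + h4 - q (n + 1) * h1 + potential p q F (n + 1) * hpq (n + 1)

lemma nonneg_of_add_eq_one (hp0 : p 0 = 1) (hpq : ∀ i, p i + q i = 1)
    (hpos : ∀ i, 1 ≤ i → 0 < p i ∧ 0 < q i) (i : ℕ) : 0 ≤ p i ∧ 0 ≤ q i := by
  rcases Nat.eq_zero_or_pos i with rfl | hi
  · constructor <;> linarith [hpq 0]
  · exact ⟨(hpos i hi).1.le, (hpos i hi).2.le⟩

lemma waitLaplace_nonneg (s : Bool) (i : ℕ) : 0 ≤ waitLaplace F s i :=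
  integral_nonneg fun _ => (Real.exp_pos _).le

variable [∀ s i, IsProbabilityMeasure (F s i)]

lemma integrable_exp_neg (hF : ∀ s i, ∀ᵐ y ∂(F s i), 0 < y) (s : Bool) (i : ℕ) :
    Integrable (fun y => Real.exp (-y)) (F s i) := by
  refine Integrable.of_bound (C := 1) (by fun_prop) ((hF s i).mono fun y hy => ?_)
  rw [Real.norm_of_nonneg (Real.exp_pos _).le]
  exact Real.exp_le_one_iff.2 (neg_nonpos.2 hy.le)

lemma waitLaplace_lt_one (hF : ∀ s i, ∀ᵐ y ∂(F s i), 0 < y) (s : Bool) (i : ℕ) :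
    waitLaplace F s i < 1 := by
  have hint := integrable_exp_neg hF s i
  have h : 0 < ∫ y, (1 - Real.exp (-y)) ∂(F s i) := by
    have hpos : ∀ᵐ y ∂(F s i), 0 < 1 - Real.exp (-y) := (hF s i).mono fun y hy =>
      sub_pos.2 (Real.exp_lt_one_iff.2 (neg_lt_zero.2 hy))
    rw [integral_pos_iff_support_of_nonneg_ae (hpos.mono fun y hy => hy.le)
      ((integrable_const 1).sub hint)]
    have : Function.support (fun y => 1 - Real.exp (-y)) =ᵐ[F s i] Set.univ :=
      eventuallyEq_univ.2 (hpos.mono fun y hy => hy.ne')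
    rw [measure_congr this]
    simp
  rw [integral_sub (integrable_const 1) hint] at h
  simpa [waitLaplace] using h

lemma laplace_lt_one (hp0 : p 0 = 1) (hpq : ∀ i, p i + q i = 1)
    (hpos : ∀ i, 1 ≤ i → 0 < p i ∧ 0 < q i) (hF : ∀ s i, ∀ᵐ y ∂(F s i), 0 < y) (i : ℕ) :
    laplace p q F i < 1 := by
  have h1 := waitLaplace_lt_one hF true i
  have h2 := waitLaplace_lt_one hF false i
  have hp : 0 < p i := by
    rcases Nat.eq_zero_or_pos i with rfl | hi
    · linarith
    · exact (hpos i hi).1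
  have hq := (nonneg_of_add_eq_one hp0 hpq hpos i).2
  rw [laplace_eq]
  nlinarith [hpq i]

lemma seriesTerm_nonneg (hp0 : p 0 = 1) (hpq : ∀ i, p i + q i = 1)
    (hpos : ∀ i, 1 ≤ i → 0 < p i ∧ 0 < q i) (hF : ∀ s i, ∀ᵐ y ∂(F s i), 0 < y) (k : ℕ) :
    0 ≤ seriesTerm p q F k := by
  have hpq0 := nonneg_of_add_eq_one hp0 hpq hpos
  refine mul_nonneg (Finset.sum_nonneg fun i _ => mul_nonneg
    (sub_nonneg.2 (laplace_lt_one hp0 hpq hpos hF i).le) (div_nonneg ?_ ?_)) (div_nonneg ?_ ?_)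
  all_goals
    refine Finset.prod_nonneg fun m _ => ?_
    first | exact (hpq0 m).1 | exact (hpq0 m).2

lemma potential_nonneg (hp0 : p 0 = 1) (hpq : ∀ i, p i + q i = 1)
    (hpos : ∀ i, 1 ≤ i → 0 < p i ∧ 0 < q i) (hF : ∀ s i, ∀ᵐ y ∂(F s i), 0 < y) (i : ℕ) :
    0 ≤ potential p q F i :=
  Finset.sum_nonneg fun k _ => seriesTerm_nonneg hp0 hpq hpos hF k

end Potential

/-! ### One-step analysis of the embedded chain -/

section Chain

variable {Ω : Type*} [MeasurableSpace Ω] {P : Measure Ω} [IsProbabilityMeasure P]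
  {p q : ℕ → ℝ} {ρ : Measure ℕ} {X : ℕ → Ω → ℕ}

lemma tsum_transProb_mul (hq0 : q 0 = 0) (f : ℕ → ℝ≥0∞) (i : ℕ) :
    ∑' j, ENNReal.ofReal (transProb p q i j) * f j =
      ENNReal.ofReal (p i) * f (i + 1) + ENNReal.ofReal (q i) * f (i - 1) := by
  rw [tsum_eq_sum (s := {i + 1, i - 1}), Finset.sum_pair (by omega)]
  · congr 1
    · simp [transProb]
    · rcases Nat.eq_zero_or_pos i with rfl | hi
      · simp [transProb, hq0]
      · have h1 : i - 1 ≠ i + 1 := by omega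
        have h2 : i - 1 + 1 = i := by omega
        simp only [transProb, if_neg h1, if_pos h2]
  · intro j hj
    simp only [Finset.mem_insert, Finset.mem_singleton, not_or] at hj
    have h2 : j + 1 ≠ i := by omega
    simp [transProb, hj.1, h2]

/-- No measurability of `G` is needed: it is a function of the first `k + 1` states, which take
countably many values. -/
lemma measurable_of_dependsOn (hX : ∀ k, Measurable (X k)) {k : ℕ} {G : (ℕ → ℕ) → ℝ≥0∞}
    (hG : ∀ x y : ℕ → ℕ, (∀ m ≤ k, x m = y m) → G x = G y) :
    Measurable fun ω => G fun m => X m ω := by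
  have h : (fun ω => G fun m => X m ω) =
      (fun z : Fin (k + 1) → ℕ => G fun m => z ⟨min m k, by omega⟩) ∘
        fun ω (m : Fin (k + 1)) => X m ω := by
    funext ω
    refine hG _ _ fun m hm => ?_
    simp [min_eq_left hm]
  rw [h]
  exact (measurable_of_countable _).comp (measurable_pi_lambda _ fun m => hX m)

/-- The Markov property, in integrated form: given the first `k + 1` states, the next step is
averaged over the transition probabilities. -/
lemma lintegral_step (hX : IsBirthDeathChain P p q ρ X) (hq0 : q 0 = 0) (k : ℕ)
    {G : (ℕ → ℕ) → ℝ≥0∞} (hG : ∀ x y : ℕ → ℕ, (∀ m ≤ k, x m = y m) → G x = G y)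
    (f : ℕ → ℕ → ℝ≥0∞) :
    ∫⁻ ω, G (fun m => X m ω) * f (X k ω) (X (k + 1) ω) ∂P =
      ∫⁻ ω, G (fun m => X m ω) * (ENNReal.ofReal (p (X k ω)) * f (X k ω) (X k ω + 1) +
        ENNReal.ofReal (q (X k ω)) * f (X k ω) (X k ω - 1)) ∂P := by
  -- the initial segment `Z` of the chain takes countably many values
  let Z : Ω → Fin (k + 1) → ℕ := fun ω m => X m ω
  let e : (Fin (k + 1) → ℕ) → ℕ → ℕ := fun z m => z ⟨min m k, by omega⟩
  have heq : ∀ ω, ∀ m ≤ k, X m ω = e (Z ω) m := fun ω m hm => by simp [Z, e, min_eq_left hm]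
  have hGe : ∀ ω, G (fun m => X m ω) = G (e (Z ω)) := fun ω => hG _ _ (heq ω)
  have hZ : Measurable Z := measurable_pi_lambda _ fun m => hX.measurable m
  have hZX : Measurable fun ω => (Z ω, X (k + 1) ω) := hZ.prodMk (hX.measurable _)
  have hmk : ∀ z j, P {ω | Z ω = z ∧ X (k + 1) ω = j} =
      P {ω | Z ω = z} * ENNReal.ofReal (transProb p q (e z k) j) := by
    intro z j
    have hm := hX.markov k (fun m => if m ≤ k then e z m else j)
    have hset : {ω | ∀ m ≤ k, X m ω = if m ≤ k then e z m else j} = {ω | Z ω = z} := by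
      ext ω
      refine ⟨fun h => funext fun m => ?_, fun h m hm => ?_⟩
      · have := h m (by omega)
        rw [if_pos (by omega)] at this
        simpa [Z, e, min_eq_left (Nat.lt_succ_iff.1 m.2)] using this
      · rw [if_pos hm, heq ω m hm, h.out]
    have hset' : {ω | ∀ m ≤ k + 1, X m ω = if m ≤ k then e z m else j} =
        {ω | Z ω = z ∧ X (k + 1) ω = j} := by
      have : {ω | Z ω = z ∧ X (k + 1) ω = j} = {ω | Z ω = z} ∩ {ω | X (k + 1) ω = j} := rfl
      rw [this, ← hset]
      ext ω
      refine ⟨fun h => ⟨fun m hm => h m (by omega), by simpa using h (k + 1) le_rfl⟩,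
        fun h m hm => ?_⟩
      rcases Nat.le_succ_iff.1 hm with h' | rfl
      · exact h.1 m h'
      · simpa using h.2.out
    rw [hset, hset'] at hm
    simp only [le_refl, if_true, Nat.not_succ_le_self, if_false] at hm
    rw [← ofReal_measureReal, hm, ENNReal.ofReal_mul measureReal_nonneg, ofReal_measureReal]
  have hL : ∫⁻ ω, G (fun m => X m ω) * f (X k ω) (X (k + 1) ω) ∂P =
      ∑' z, ∑' j, G (e z) * f (e z k) j *
        (P {ω | Z ω = z} * ENNReal.ofReal (transProb p q (e z k) j)) := by
    calc _ = ∫⁻ ω, (fun a : (Fin (k + 1) → ℕ) × ℕ => G (e a.1) * f (e a.1 k) a.2)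
            (Z ω, X (k + 1) ω) ∂P := by
          refine lintegral_congr fun ω => ?_
          rw [hGe, heq ω k le_rfl]
      _ = ∑' a : (Fin (k + 1) → ℕ) × ℕ, G (e a.1) * f (e a.1 k) a.2 *
            P {ω | Z ω = a.1 ∧ X (k + 1) ω = a.2} := by
          rw [← lintegral_map (f := fun a : (Fin (k + 1) → ℕ) × ℕ => G (e a.1) * f (e a.1 k) a.2)
            (measurable_of_countable _) hZX, lintegral_countable']
          refine tsum_congr fun a => ?_
          rw [Measure.map_apply hZX (measurableSet_singleton a)]
          congr 2
          ext ω
          simp [Prod.ext_iff]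
      _ = _ := by
          rw [ENNReal.tsum_prod']
          simp only [hmk]
  have hR : ∀ g : (Fin (k + 1) → ℕ) → ℝ≥0∞, ∫⁻ ω, g (Z ω) ∂P = ∑' z, g z * P {ω | Z ω = z} := by
    intro g
    rw [← lintegral_map (measurable_of_countable _) hZ, lintegral_countable']
    refine tsum_congr fun z => ?_
    rw [Measure.map_apply hZ (measurableSet_singleton z)]
    rfl
  rw [hL]
  calc _ = ∑' z, (G (e z) * (ENNReal.ofReal (p (e z k)) * f (e z k) (e z k + 1) +
        ENNReal.ofReal (q (e z k)) * f (e z k) (e z k - 1))) * P {ω | Z ω = z} := by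
        refine tsum_congr fun z => ?_
        rw [← tsum_transProb_mul hq0 (f (e z k)), mul_right_comm, ← ENNReal.tsum_mul_left]
        refine tsum_congr fun j => ?_
        ring
    _ = _ := by
        rw [← hR fun z => G (e z) * (ENNReal.ofReal (p (e z k)) * f (e z k) (e z k + 1) +
          ENNReal.ofReal (q (e z k)) * f (e z k) (e z k - 1))]
        refine lintegral_congr fun ω => ?_
        rw [hGe, heq ω k le_rfl]

lemma lintegral_one_step (hX : IsBirthDeathChain P p q ρ X) (hq0 : q 0 = 0) (k : ℕ)
    (f : ℕ → ℕ → ℝ≥0∞) :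
    ∫⁻ ω, f (X k ω) (X (k + 1) ω) ∂P =
      ∫⁻ ω, (ENNReal.ofReal (p (X k ω)) * f (X k ω) (X k ω + 1) +
        ENNReal.ofReal (q (X k ω)) * f (X k ω) (X k ω - 1)) ∂P := by
  simpa using lintegral_step hX hq0 k (G := fun _ => 1) (fun _ _ _ => rfl) f

lemma ae_unit_steps (hX : IsBirthDeathChain P p q ρ X) (hq0 : q 0 = 0) :
    ∀ᵐ ω ∂P, ∀ k, X (k + 1) ω = X k ω + 1 ∨ X (k + 1) ω + 1 = X k ω := by
  refine ae_all_iff.2 fun k => ?_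
  have hm : Measurable fun ω => if X (k + 1) ω = X k ω + 1 ∨ X (k + 1) ω + 1 = X k ω then
      (0 : ℝ≥0∞) else 1 :=
    (measurable_of_countable fun a : ℕ × ℕ => if a.2 = a.1 + 1 ∨ a.2 + 1 = a.1 then
      (0 : ℝ≥0∞) else 1).comp ((hX.measurable k).prodMk (hX.measurable (k + 1)))
  have h := lintegral_one_step hX hq0 k fun i j =>
    if j = i + 1 ∨ j + 1 = i then (0 : ℝ≥0∞) else 1
  have h0 : ∀ i, ENNReal.ofReal (q i) *
      (if i - 1 = i + 1 ∨ i - 1 + 1 = i then (0 : ℝ≥0∞) else 1) = 0 := by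
    intro i
    rcases Nat.eq_zero_or_pos i with rfl | hi
    · simp [hq0]
    · rw [if_pos (Or.inr (by omega)), mul_zero]
  simp only [true_or, if_true, mul_zero, h0, add_zero, lintegral_zero] at h
  filter_upwards [(lintegral_eq_zero_iff hm).1 h] with ω hω
  by_contra hne
  simp [hne] at hω

/-- The discount `c (x 0) * ∏_{j < k} γ (x j) (x (j + 1))` accumulated along a path in its first `k`
steps. -/
noncomputable def discount (c : ℕ → ℝ≥0∞) (γ : ℕ → ℕ → ℝ≥0∞) (k : ℕ) (x : ℕ → ℕ) : ℝ≥0∞ :=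
  c (x 0) * ∏ j ∈ Finset.range k, γ (x j) (x (j + 1))

lemma discount_congr (c : ℕ → ℝ≥0∞) (γ : ℕ → ℕ → ℝ≥0∞) (k : ℕ) (x y : ℕ → ℕ)
    (h : ∀ m ≤ k, x m = y m) : discount c γ k x = discount c γ k y := by
  unfold discount
  rw [h 0 (Nat.zero_le k)]
  congr 1
  refine Finset.prod_congr rfl fun j hj => ?_
  have := Finset.mem_range.1 hj
  rw [h j (by omega), h (j + 1) (by omega)]

lemma measurable_discount_mul (hX : ∀ k, Measurable (X k)) (c : ℕ → ℝ≥0∞)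
    (γ : ℕ → ℕ → ℝ≥0∞) (h : ℕ → ℝ≥0∞) (k : ℕ) :
    Measurable fun ω => discount c γ k (fun m => X m ω) * h (X k ω) :=
  (measurable_of_dependsOn hX (discount_congr c γ k)).mul
    ((measurable_of_countable h).comp (hX k))

/-- A Lyapunov function `u` whose discounted mean drops by at least `h` in each step bounds the
total discounted cost `h` and all later discounted values of `u`. -/
lemma sum_lintegral_discount_le (hX : IsBirthDeathChain P p q ρ X) (hq0 : q 0 = 0)
    (c : ℕ → ℝ≥0∞) {γ : ℕ → ℕ → ℝ≥0∞} {u h : ℕ → ℝ≥0∞}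
    (hu : ∀ i, ENNReal.ofReal (p i) * (γ i (i + 1) * u (i + 1)) +
      ENNReal.ofReal (q i) * (γ i (i - 1) * u (i - 1)) + h i ≤ u i) (n : ℕ) :
    ∑ k ∈ Finset.range n, ∫⁻ ω, discount c γ k (fun m => X m ω) * h (X k ω) ∂P +
      ∫⁻ ω, discount c γ n (fun m => X m ω) * u (X n ω) ∂P ≤
        ∫⁻ ω, c (X 0 ω) * u (X 0 ω) ∂P := by
  induction n with
  | zero => simp [discount]
  | succ n ih =>
    refine le_trans ?_ ih
    rw [Finset.sum_range_succ, add_assoc]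
    refine add_le_add le_rfl ?_
    have h1 := lintegral_step hX hq0 n (discount_congr c γ n) fun i j => γ i j * u j
    have h2 : ∀ ω, discount c γ (n + 1) (fun m => X m ω) * u (X (n + 1) ω) =
        discount c γ n (fun m => X m ω) * (γ (X n ω) (X (n + 1) ω) * u (X (n + 1) ω)) := by
      intro ω
      simp only [discount, Finset.prod_range_succ]
      ring
    simp only [h2]
    rw [h1, ← lintegral_add_left (measurable_discount_mul hX.measurable c γ h n)]
    refine lintegral_mono fun ω => ?_
    change _ * _ + _ * _ ≤ _
    rw [← mul_add, add_comm]
    exact mul_le_mul_right (hu _) _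

/-- If the total cost `∑ h (xₖ)` of a path is finite and `h` is positive, then each state is visited
finitely often. -/
lemma tendsto_atTop_of_tsum_ne_top {h : ℕ → ℝ≥0∞} (hpos : ∀ i, 0 < h i) {x : ℕ → ℕ}
    (hx : ∑' k, h (x k) ≠ ∞) : Tendsto x atTop atTop := by
  refine tendsto_atTop.2 fun b => ?_
  have h0 := ENNReal.tendsto_atTop_zero_of_tsum_ne_top hx
  have hev : ∀ᶠ k in atTop, ∀ i ∈ Finset.range b, h (x k) < h i :=
    (Filter.eventually_all_finset _).2 fun i _ => h0.eventually_lt_const (hpos i)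
  filter_upwards [hev] with k hk
  by_contra hlt
  exact lt_irrefl _ (hk (x k) (Finset.mem_range.2 (by omega)))

end Chain

/-! ### Averaging over the waiting times -/

section Walk

variable {Ω : Type*} [MeasurableSpace Ω] {P : Measure Ω}
  {p q : ℕ → ℝ} {F : Bool → ℕ → Measure ℝ} {ρ : Measure ℕ}
  {X : ℕ → Ω → ℕ} {τ : Bool → ℕ → ℕ → Ω → ℝ}

/-- As the chain and the waiting times are independent, expectations can be computed by averaging
first over the waiting times with the path of the chain fixed. -/
lemma lintegral_chain_wait [IsProbabilityMeasure P] (hX : IsRandomWalk P p q F ρ X τ)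
    {K : (ℕ → ℕ) × (Bool × ℕ × ℕ → ℝ) → ℝ≥0∞} (hK : Measurable K) :
    ∫⁻ ω, K (fun k => X k ω, fun j => τ j.1 j.2.1 j.2.2 ω) ∂P =
      ∫⁻ ω, ∫⁻ ω', K (fun k => X k ω, fun j => τ j.1 j.2.1 j.2.2 ω') ∂P ∂P := by
  have hm1 : Measurable fun ω k => X k ω := measurable_pi_lambda _ hX.chain.measurable
  have hm2 : Measurable fun ω (j : Bool × ℕ × ℕ) => τ j.1 j.2.1 j.2.2 ω :=
    measurable_pi_lambda _ fun j => hX.measurable _ _ _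
  have h := (indepFun_iff_map_prod_eq_prod_map_map hm1.aemeasurable hm2.aemeasurable).1
    hX.indep_chain
  have : IsProbabilityMeasure (P.map fun ω (j : Bool × ℕ × ℕ) => τ j.1 j.2.1 j.2.2 ω) :=
    Measure.isProbabilityMeasure_map hm2.aemeasurable
  rw [← lintegral_map hK (hm1.prodMk hm2), h, lintegral_prod _ hK.aemeasurable,
    lintegral_map hK.lintegral_prod_right' hm1]
  refine lintegral_congr fun ω => ?_
  exact lintegral_map (hK.comp measurable_prodMk_left) hm2

lemma measurable_wait (k : ℕ) : Measurable fun a : (ℕ → ℕ) × (Bool × ℕ × ℕ → ℝ) =>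
    wait a.1 (fun s i k => a.2 (s, i, k)) k := by
  have h1 : Measurable fun b : (ℕ × ℕ) × (Bool × ℕ × ℕ → ℝ) =>
      b.2 (decide (b.1.2 = b.1.1 + 1), b.1.1, k) :=
    measurable_from_prod_countable_right fun i =>
      measurable_pi_apply (decide (i.2 = i.1 + 1), i.1, k)
  have h2 : Measurable fun a : (ℕ → ℕ) × (Bool × ℕ × ℕ → ℝ) => ((a.1 k, a.1 (k + 1)), a.2) := by
    fun_prop
  simp only [wait_eq]
  exact h1.comp h2

lemma measurable_jumpTime (k : ℕ) : Measurable fun a : (ℕ → ℕ) × (Bool × ℕ × ℕ → ℝ) =>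
    jumpTime a.1 (fun s i k => a.2 (s, i, k)) k := by
  simp only [jumpTime_eq_sum]
  exact Finset.measurable_sum _ fun j _ => measurable_wait j

lemma measurable_chain_wait (hX : IsRandomWalk P p q F ρ X τ) :
    Measurable fun ω => ((fun k => X k ω : ℕ → ℕ),
      (fun j => τ j.1 j.2.1 j.2.2 ω : Bool × ℕ × ℕ → ℝ)) :=
  (measurable_pi_lambda _ hX.chain.measurable).prodMk
    (measurable_pi_lambda _ fun _ => hX.measurable _ _ _)

lemma ae_wait_pos (hX : IsRandomWalk P p q F ρ X τ) (hF : ∀ s i, ∀ᵐ y ∂(F s i), 0 < y) :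
    ∀ᵐ ω ∂P, ∀ s i k, 0 < τ s i k ω := by
  simp only [ae_all_iff]
  intro s i k
  have h := hF s i
  rw [← hX.law s i k] at h
  exact ae_of_ae_map (hX.measurable s i k).aemeasurable h

variable [∀ s i, IsProbabilityMeasure (F s i)]

lemma lintegral_exp_neg_wait (hX : IsRandomWalk P p q F ρ X τ)
    (hF : ∀ s i, ∀ᵐ y ∂(F s i), 0 < y) (s : Bool) (i k : ℕ) :
    ∫⁻ ω, ENNReal.ofReal (Real.exp (-τ s i k ω)) ∂P = ENNReal.ofReal (waitLaplace F s i) := by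
  rw [waitLaplace, ofReal_integral_eq_lintegral_ofReal (integrable_exp_neg hF s i)
    (ae_of_all _ fun y => (Real.exp_pos _).le), ← hX.law s i k,
    lintegral_map (by fun_prop) (hX.measurable s i k)]

lemma lintegral_one_sub_exp_neg_wait (hX : IsRandomWalk P p q F ρ X τ)
    (hF : ∀ s i, ∀ᵐ y ∂(F s i), 0 < y) (s : Bool) (i k : ℕ) :
    ∫⁻ ω, ENNReal.ofReal (1 - Real.exp (-τ s i k ω)) ∂P =
      ENNReal.ofReal (1 - waitLaplace F s i) := by
  have h1 : 1 - waitLaplace F s i = ∫ y, (1 - Real.exp (-y)) ∂(F s i) := by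
    rw [integral_sub (integrable_const 1) (integrable_exp_neg hF s i)]
    simp [waitLaplace]
  rw [h1, ofReal_integral_eq_lintegral_ofReal
    (f := fun y => 1 - Real.exp (-y)) ((integrable_const 1).sub (integrable_exp_neg hF s i))
    ((hF s i).mono fun y hy => sub_nonneg.2 (Real.exp_le_one_iff.2 (neg_nonpos.2 hy.le))),
    ← hX.law s i k, lintegral_map (by fun_prop) (hX.measurable s i k)]

/-- The Laplace transform at `1` of the waiting time at `i` before a jump to `j`. -/
noncomputable def stepLaplace (F : Bool → ℕ → Measure ℝ) (i j : ℕ) : ℝ≥0∞ :=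
  ENNReal.ofReal (waitLaplace F (decide (j = i + 1)) i)

/-- Given the path of the chain, the waiting times in `T k` are independent: they have different
copy numbers. -/
lemma lintegral_exp_neg_jumpTime_path (hX : IsRandomWalk P p q F ρ X τ)
    (hF : ∀ s i, ∀ᵐ y ∂(F s i), 0 < y) (x : ℕ → ℕ) (k : ℕ) :
    ∫⁻ ω, ENNReal.ofReal (Real.exp (-jumpTime x (fun s i k => τ s i k ω) k)) ∂P =
      discount 1 (stepLaplace F) k x := by
  let g : ℕ → Bool × ℕ × ℕ := fun j => (decide (x (j + 1) = x j + 1), x j, j)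
  have hg : Function.Injective g := fun a b h => (Prod.ext_iff.1 (Prod.ext_iff.1 h).2).2
  have hind : iIndepFun (fun j ω =>
      ENNReal.ofReal (Real.exp (-τ (g j).1 (g j).2.1 (g j).2.2 ω))) P :=
    (hX.indep.precomp hg).comp (fun _ y => ENNReal.ofReal (Real.exp (-y))) fun _ => by fun_prop
  have h := lintegral_prod_eq_prod_lintegral_of_indepFun (Finset.range k) _ hind fun j =>
    (Real.measurable_exp.comp (hX.measurable (g j).1 (g j).2.1 (g j).2.2).neg).ennreal_ofReal
  simp only [lintegral_exp_neg_wait hX hF] at h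
  simp only [discount, Pi.one_apply, one_mul]
  refine Eq.trans (lintegral_congr fun ω => ?_) h
  rw [jumpTime_eq_sum, ← Finset.sum_neg_distrib, Real.exp_sum,
    ENNReal.ofReal_prod_of_nonneg fun _ _ => (Real.exp_pos _).le]
  simp only [wait_eq, g]

variable [IsProbabilityMeasure P]

lemma lintegral_exp_neg_jumpTime (hX : IsRandomWalk P p q F ρ X τ)
    (hF : ∀ s i, ∀ᵐ y ∂(F s i), 0 < y) (k : ℕ) :
    ∫⁻ ω, ENNReal.ofReal
        (Real.exp (-jumpTime (fun k => X k ω) (fun s i k => τ s i k ω) k)) ∂P =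
      ∫⁻ ω, discount 1 (stepLaplace F) k (fun m => X m ω) ∂P := by
  have hm : Measurable fun a : (ℕ → ℕ) × (Bool × ℕ × ℕ → ℝ) =>
      ENNReal.ofReal (Real.exp (-jumpTime a.1 (fun s i k => a.2 (s, i, k)) k)) :=
    (Real.measurable_exp.comp (measurable_jumpTime k).neg).ennreal_ofReal
  refine (lintegral_chain_wait hX hm).trans (lintegral_congr fun ω => ?_)
  exact lintegral_exp_neg_jumpTime_path hX hF (fun m => X m ω) k

lemma lintegral_one_sub_exp_neg (hX : IsRandomWalk P p q F ρ X τ)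
    (hp0 : p 0 = 1) (hpq : ∀ i, p i + q i = 1) (hpos : ∀ i, 1 ≤ i → 0 < p i ∧ 0 < q i)
    (hF : ∀ s i, ∀ᵐ y ∂(F s i), 0 < y) (k : ℕ) :
    ∫⁻ ω, ENNReal.ofReal
        (1 - Real.exp (-wait (fun k => X k ω) (fun s i k => τ s i k ω) k)) ∂P =
      ∫⁻ ω, ENNReal.ofReal (1 - laplace p q F (X k ω)) ∂P := by
  have hm : Measurable fun a : (ℕ → ℕ) × (Bool × ℕ × ℕ → ℝ) =>
      ENNReal.ofReal (1 - Real.exp (-wait a.1 (fun s i k => a.2 (s, i, k)) k)) :=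
    ((Real.measurable_exp.comp (measurable_wait k).neg).const_sub 1).ennreal_ofReal
  have hq0 : q 0 = 0 := by linarith [hpq 0]
  have h1 := lintegral_one_step hX.chain hq0 k fun i j =>
    ENNReal.ofReal (1 - waitLaplace F (decide (j = i + 1)) i)
  refine (lintegral_chain_wait hX hm).trans (Eq.trans (lintegral_congr fun ω => ?_)
    (h1.trans (lintegral_congr fun ω => ?_)))
  · simp only [wait_eq]
    exact lintegral_one_sub_exp_neg_wait hX hF _ _ _
  · have hne : ¬ X k ω - 1 = X k ω + 1 := by omega
    have hp := (nonneg_of_add_eq_one hp0 hpq hpos (X k ω)).1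
    have hq := (nonneg_of_add_eq_one hp0 hpq hpos (X k ω)).2
    have ht := sub_nonneg.2 (waitLaplace_lt_one hF true (X k ω)).le
    have hf := sub_nonneg.2 (waitLaplace_lt_one hF false (X k ω)).le
    simp only [hne, decide_true, decide_false]
    rw [← ENNReal.ofReal_mul hp, ← ENNReal.ofReal_mul hq,
      ← ENNReal.ofReal_add (mul_nonneg hp ht) (mul_nonneg hq hf), laplace_eq]
    congr 1
    linear_combination hpq (X k ω)

/-! ### The two alternatives -/

lemma summable_seriesTerm (hp0 : p 0 = 1) (hpq : ∀ i, p i + q i = 1)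
    (hpos : ∀ i, 1 ≤ i → 0 < p i ∧ 0 < q i) (hF : ∀ s i, ∀ᵐ y ∂(F s i), 0 < y)
    (hS : explosionSeries p q F ≠ ∞) : Summable (seriesTerm p q F) := by
  have h := ENNReal.summable_toReal hS
  exact h.congr fun k => ENNReal.toReal_ofReal (seriesTerm_nonneg hp0 hpq hpos hF k)

lemma tendsto_potential (hp0 : p 0 = 1) (hpq : ∀ i, p i + q i = 1)
    (hpos : ∀ i, 1 ≤ i → 0 < p i ∧ 0 < q i) (hF : ∀ s i, ∀ᵐ y ∂(F s i), 0 < y)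
    (hS : explosionSeries p q F = ∞) :
    Tendsto (fun i => ENNReal.ofReal (potential p q F i)) atTop (𝓝 ∞) := by
  have h : Tendsto (fun i => ∑ k ∈ Finset.range i, ENNReal.ofReal (seriesTerm p q F k)) atTop
      (𝓝 (explosionSeries p q F)) := ENNReal.tendsto_nat_tsum _
  rw [hS] at h
  refine h.congr fun i => ?_
  rw [potential, ENNReal.ofReal_sum_of_nonneg fun k _ => seriesTerm_nonneg hp0 hpq hpos hF k]

/-- If the explosion series is finite with sum `S`, then `S - W` is a bounded Lyapunov function with
drift `-(1 - E e^{-τ})`, so that the total cost has mean at most `S`. -/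
lemma tsum_lintegral_one_sub_laplace_ne_top (hX : IsRandomWalk P p q F ρ X τ)
    (hp0 : p 0 = 1) (hpq : ∀ i, p i + q i = 1) (hpos : ∀ i, 1 ≤ i → 0 < p i ∧ 0 < q i)
    (hF : ∀ s i, ∀ᵐ y ∂(F s i), 0 < y) (hS : explosionSeries p q F ≠ ∞) :
    ∑' k, ∫⁻ ω, ENNReal.ofReal (1 - laplace p q F (X k ω)) ∂P ≠ ∞ := by
  have hs := summable_seriesTerm hp0 hpq hpos hF hS
  have hn := seriesTerm_nonneg hp0 hpq hpos hF
  set S : ℝ := ∑' k, seriesTerm p q F k with hSdef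
  have hW : ∀ i, 0 ≤ S - potential p q F i := fun i =>
    sub_nonneg.2 (hs.sum_le_tsum _ fun k _ => hn k)
  have hq0 : q 0 = 0 := by linarith [hpq 0]
  have hu : ∀ i, ENNReal.ofReal (p i) * (1 * ENNReal.ofReal (S - potential p q F (i + 1))) +
      ENNReal.ofReal (q i) * (1 * ENNReal.ofReal (S - potential p q F (i - 1))) +
      ENNReal.ofReal (1 - laplace p q F i) ≤ ENNReal.ofReal (S - potential p q F i) := by
    intro i
    have hp := (nonneg_of_add_eq_one hp0 hpq hpos i).1
    have hq := (nonneg_of_add_eq_one hp0 hpq hpos i).2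
    rw [one_mul, one_mul, ← ENNReal.ofReal_mul hp, ← ENNReal.ofReal_mul hq,
      ← ENNReal.ofReal_add (mul_nonneg hp (hW _)) (mul_nonneg hq (hW _)),
      ← ENNReal.ofReal_add (add_nonneg (mul_nonneg hp (hW _)) (mul_nonneg hq (hW _)))
        (sub_nonneg.2 (laplace_lt_one hp0 hpq hpos hF i).le)]
    refine ENNReal.ofReal_le_ofReal (le_of_eq ?_)
    linear_combination S * hpq i - potential_step (F := F) hp0 hpq hpos i
  have hb : ∀ n, ∑ k ∈ Finset.range n, ∫⁻ ω, ENNReal.ofReal (1 - laplace p q F (X k ω)) ∂P ≤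
      ENNReal.ofReal S := by
    intro n
    have h := (le_add_right le_rfl).trans
      (sum_lintegral_discount_le hX.chain hq0 1 (γ := fun _ _ => 1) hu n)
    simp only [discount, Pi.one_apply, Finset.prod_const_one, one_mul] at h
    refine h.trans ?_
    calc _ ≤ ∫⁻ _, ENNReal.ofReal S ∂P := lintegral_mono fun ω => ENNReal.ofReal_le_ofReal
          (sub_le_self _ (potential_nonneg hp0 hpq hpos hF _))
      _ = ENNReal.ofReal S := by simp
  rw [ENNReal.tsum_eq_iSup_nat]
  exact ((iSup_le hb).trans_lt ENNReal.ofReal_lt_top).ne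

lemma ae_explodes (hX : IsRandomWalk P p q F ρ X τ)
    (hp0 : p 0 = 1) (hpq : ∀ i, p i + q i = 1) (hpos : ∀ i, 1 ≤ i → 0 < p i ∧ 0 < q i)
    (hF : ∀ s i, ∀ᵐ y ∂(F s i), 0 < y) (hS : explosionSeries p q F ≠ ∞) :
    ∀ᵐ ω ∂P, Explodes (fun k => X k ω) (fun s i k => τ s i k ω) := by
  have hq0 : q 0 = 0 := by linarith [hpq 0]
  have hfin := tsum_lintegral_one_sub_laplace_ne_top hX hp0 hpq hpos hF hS
  have hm1 : ∀ k, Measurable fun ω => ENNReal.ofReal (1 - laplace p q F (X k ω)) := fun k =>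
    (measurable_of_countable fun i => ENNReal.ofReal (1 - laplace p q F i)).comp
      (hX.chain.measurable k)
  have hm2 : ∀ k, Measurable fun ω => ENNReal.ofReal
      (1 - Real.exp (-wait (fun k => X k ω) (fun s i k => τ s i k ω) k)) := fun k =>
    ((Real.measurable_exp.comp
      ((measurable_wait k).comp (measurable_chain_wait hX)).neg).const_sub 1).ennreal_ofReal
  have h1 : ∀ᵐ ω ∂P, ∑' k, ENNReal.ofReal (1 - laplace p q F (X k ω)) < ∞ := by
    refine ae_lt_top (Measurable.tsum hm1) ?_
    rwa [lintegral_tsum fun k => (hm1 k).aemeasurable]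
  have h2 : ∀ᵐ ω ∂P, ∑' k, ENNReal.ofReal
      (1 - Real.exp (-wait (fun k => X k ω) (fun s i k => τ s i k ω) k)) < ∞ := by
    refine ae_lt_top (Measurable.tsum hm2) ?_
    rw [lintegral_tsum fun k => (hm2 k).aemeasurable]
    simpa only [lintegral_one_sub_exp_neg hX hp0 hpq hpos hF] using hfin
  filter_upwards [h1, h2, ae_wait_pos hX hF, ae_unit_steps hX.chain hq0] with ω ha hb hw hx
  refine explodes_of_summable hw hx ?_ (summable_of_tsum_one_sub_exp_ne_top (fun k => ?_) hb.ne)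
  · exact tendsto_atTop_of_tsum_ne_top (h := fun i => ENNReal.ofReal (1 - laplace p q F i))
      (fun i => ENNReal.ofReal_pos.2 (sub_pos.2 (laplace_lt_one hp0 hpq hpos hF i))) ha.ne
  · rw [wait_eq]
    exact (hw _ _ _).le

lemma stepLaplace_le_one (hF : ∀ s i, ∀ᵐ y ∂(F s i), 0 < y) (i j : ℕ) :
    stepLaplace F i j ≤ 1 :=
  ENNReal.ofReal_le_one.2 (waitLaplace_lt_one hF _ _).le

lemma antitone_discount (hF : ∀ s i, ∀ᵐ y ∂(F s i), 0 < y) (x : ℕ → ℕ) :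
    Antitone fun k => discount 1 (stepLaplace F) k x :=
  antitone_nat_of_succ_le fun k => by
    simp only [discount, Finset.prod_range_succ, ← mul_assoc]
    exact mul_le_of_le_one_right' (stepLaplace_le_one hF _ _)

/-- The function `2 + W` is a Lyapunov function, with drift at most `-(1 - E e^{-τ})`, for the chain
discounted by the Laplace transforms of the waiting times. -/
lemma potential_add_two_step (hp0 : p 0 = 1) (hpq : ∀ i, p i + q i = 1)
    (hpos : ∀ i, 1 ≤ i → 0 < p i ∧ 0 < q i) (hF : ∀ s i, ∀ᵐ y ∂(F s i), 0 < y) (i : ℕ) :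
    ENNReal.ofReal (p i) *
        (stepLaplace F i (i + 1) * ENNReal.ofReal (2 + potential p q F (i + 1))) +
      ENNReal.ofReal (q i) *
        (stepLaplace F i (i - 1) * ENNReal.ofReal (2 + potential p q F (i - 1))) +
      ENNReal.ofReal (1 - laplace p q F i) ≤ ENNReal.ofReal (2 + potential p q F i) := by
  have hp := (nonneg_of_add_eq_one hp0 hpq hpos i).1
  have hq := (nonneg_of_add_eq_one hp0 hpq hpos i).2
  have hW := potential_nonneg hp0 hpq hpos hF
  have hu : ∀ j, 0 ≤ 2 + potential p q F j := fun j => by linarith [hW j]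
  have ht := waitLaplace_nonneg (F := F) true i
  have hf := waitLaplace_nonneg (F := F) false i
  have hne : ¬ i - 1 = i + 1 := by omega
  simp only [stepLaplace, hne, decide_true, decide_false]
  have h1 := mul_nonneg hp (mul_nonneg ht (hu (i + 1)))
  have h2 := mul_nonneg hq (mul_nonneg hf (hu (i - 1)))
  rw [← ENNReal.ofReal_mul ht, ← ENNReal.ofReal_mul hf, ← ENNReal.ofReal_mul hp,
    ← ENNReal.ofReal_mul hq, ← ENNReal.ofReal_add h1 h2,
    ← ENNReal.ofReal_add (add_nonneg h1 h2)
      (sub_nonneg.2 (laplace_lt_one hp0 hpq hpos hF i).le)]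
  refine ENNReal.ofReal_le_ofReal ?_
  have h3 := mul_nonneg (mul_nonneg hp (sub_nonneg.2 (waitLaplace_lt_one hF true i).le))
    (hW (i + 1))
  have h4 := mul_nonneg (mul_nonneg hq (sub_nonneg.2 (waitLaplace_lt_one hF false i).le))
    (hW (i - 1))
  have h5 := potential_step (F := F) hp0 hpq hpos i
  rw [laplace_eq] at h5 ⊢
  -- discounting `2 + W` loses at least twice `1 - E e^{-τ}`, while the drift of `W` gains it once
  linear_combination h3 + h4 + h5

/-- If the explosion series diverges, the discount by the Laplace transforms of the waiting times
tends to zero along almost every path: otherwise the chain tends to infinity, where the Lyapunov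
function `2 + W` is infinite, although its discounted values have bounded means. -/
lemma ae_tendsto_discount_zero (hX : IsRandomWalk P p q F ρ X τ)
    (hp0 : p 0 = 1) (hpq : ∀ i, p i + q i = 1) (hpos : ∀ i, 1 ≤ i → 0 < p i ∧ 0 < q i)
    (hF : ∀ s i, ∀ᵐ y ∂(F s i), 0 < y) (hS : explosionSeries p q F = ∞) :
    ∀ᵐ ω ∂P, Tendsto (fun k => discount 1 (stepLaplace F) k fun m => X m ω) atTop (𝓝 0) := by
  have hq0 : q 0 = 0 := by linarith [hpq 0]
  let h : ℕ → ℝ≥0∞ := fun i => ENNReal.ofReal (1 - laplace p q F i)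
  let u : ℕ → ℝ≥0∞ := fun i => ENNReal.ofReal (2 + potential p q F i)
  have hh : ∀ i, 0 < h i := fun i =>
    ENNReal.ofReal_pos.2 (sub_pos.2 (laplace_lt_one hp0 hpq hpos hF i))
  have hut : Tendsto u atTop (𝓝 ∞) := by
    refine tendsto_nhds_top_mono (tendsto_potential hp0 hpq hpos hF hS)
      (Eventually.of_forall fun i => ENNReal.ofReal_le_ofReal (by linarith))
  -- the initial law is arbitrary and `u (X 0)` may have infinite mean, so the start is fixed first
  suffices hm : ∀ m, ∀ᵐ ω ∂P, X 0 ω = m →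
      Tendsto (fun k => discount 1 (stepLaplace F) k fun m => X m ω) atTop (𝓝 0) by
    filter_upwards [ae_all_iff.2 hm] with ω hω using hω _ rfl
  intro m
  let c : ℕ → ℝ≥0∞ := fun i => if i = m then 1 else 0
  have hc : ∀ i, c i * u i ≤ u m := fun i => by
    by_cases hi : i = m <;> simp [c, hi]
  have hb : ∀ n, ∑ k ∈ Finset.range n,
      ∫⁻ ω, discount c (stepLaplace F) k (fun m => X m ω) * h (X k ω) ∂P +
      ∫⁻ ω, discount c (stepLaplace F) n (fun m => X m ω) * u (X n ω) ∂P ≤ u m := fun n =>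
    (sum_lintegral_discount_le hX.chain hq0 c
      (potential_add_two_step hp0 hpq hpos hF) n).trans <|
      (lintegral_mono fun ω => hc (X 0 ω)).trans (by simp)
  have hmeas := measurable_discount_mul hX.chain.measurable c (stepLaplace F)
  have h1 : ∀ᵐ ω ∂P, ∑' k, discount c (stepLaplace F) k (fun m => X m ω) * h (X k ω) < ∞ := by
    refine ae_lt_top (Measurable.tsum (hmeas h)) ?_
    rw [lintegral_tsum fun k => (hmeas h k).aemeasurable, ENNReal.tsum_eq_iSup_nat]
    exact ((iSup_le fun n => (le_add_right le_rfl).trans (hb n)).trans_lt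
      ENNReal.ofReal_lt_top).ne
  have h2 : ∀ᵐ ω ∂P,
      liminf (fun k => discount c (stepLaplace F) k (fun m => X m ω) * u (X k ω)) atTop < ∞ := by
    refine ae_lt_top (Measurable.liminf (hmeas u)) ?_
    refine ((lintegral_liminf_le (hmeas u)).trans ?_).trans_lt
      (ENNReal.ofReal_lt_top : u m < ∞) |>.ne
    exact (liminf_le_liminf (Eventually.of_forall fun n =>
      (le_add_left le_rfl).trans (hb n))).trans (liminf_const _).le
  filter_upwards [h1, h2] with ω ha hl h0
  have hcd : ∀ k, discount c (stepLaplace F) k (fun m => X m ω) =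
      discount 1 (stepLaplace F) k fun m => X m ω := fun k => by simp [discount, c, h0]
  simp only [hcd] at ha hl
  have hanti := antitone_discount hF fun m => X m ω
  have hlim := tendsto_atTop_iInf hanti
  set r := ⨅ k, discount 1 (stepLaplace F) k fun m => X m ω with hr
  by_cases hr0 : r = 0
  · rwa [hr0] at hlim
  exfalso
  have hrle : ∀ k, r ≤ discount 1 (stepLaplace F) k fun m => X m ω := fun k => iInf_le _ k
  have hXt : Tendsto (fun k => X k ω) atTop atTop := by
    refine tendsto_atTop_of_tsum_ne_top hh fun htop => ?_
    have : ∑' k, r * h (X k ω) < ∞ :=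
      (ENNReal.tsum_le_tsum fun k => mul_le_mul_left (hrle k) _).trans_lt ha
    rw [ENNReal.tsum_mul_left, htop, ENNReal.mul_top hr0] at this
    exact lt_irrefl _ this
  have hru : Tendsto (fun k => r * u (X k ω)) atTop (𝓝 ∞) := by
    have := ENNReal.Tendsto.const_mul (a := r) (hut.comp hXt) (Or.inl ENNReal.top_ne_zero)
    rwa [ENNReal.mul_top hr0] at this
  have := tendsto_nhds_top_mono hru
    (Eventually.of_forall fun k => mul_le_mul_left (hrle k) (u (X k ω)))
  rw [this.liminf_eq] at hl
  exact lt_irrefl _ hl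

lemma ae_not_explodes (hX : IsRandomWalk P p q F ρ X τ)
    (hp0 : p 0 = 1) (hpq : ∀ i, p i + q i = 1) (hpos : ∀ i, 1 ≤ i → 0 < p i ∧ 0 < q i)
    (hF : ∀ s i, ∀ᵐ y ∂(F s i), 0 < y) (hS : explosionSeries p q F = ∞) :
    ∀ᵐ ω ∂P, ¬ Explodes (fun k => X k ω) (fun s i k => τ s i k ω) := by
  have h1 : Tendsto (fun k => ∫⁻ ω, ENNReal.ofReal
      (Real.exp (-jumpTime (fun k => X k ω) (fun s i k => τ s i k ω) k)) ∂P) atTop (𝓝 0) := by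
    simp only [lintegral_exp_neg_jumpTime hX hF]
    have := tendsto_lintegral_of_dominated_convergence (μ := P)
      (F := fun k ω => discount 1 (stepLaplace F) k fun m => X m ω) (f := fun _ => 0) 1
      (fun k => measurable_of_dependsOn hX.chain.measurable (discount_congr 1 _ k))
      (fun k => ae_of_all _ fun ω => ?_) (by simp)
      (ae_tendsto_discount_zero hX hp0 hpq hpos hF hS)
    · simpa using this
    · simpa [discount] using antitone_discount hF (fun m => X m ω) (Nat.zero_le k)
  have hm : ∀ k, Measurable fun ω => ENNReal.ofReal
      (Real.exp (-jumpTime (fun k => X k ω) (fun s i k => τ s i k ω) k)) := fun k =>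
    (Real.measurable_exp.comp
      ((measurable_jumpTime k).comp (measurable_chain_wait hX)).neg).ennreal_ofReal
  have h2 : ∫⁻ ω, liminf (fun k => ENNReal.ofReal
      (Real.exp (-jumpTime (fun k => X k ω) (fun s i k => τ s i k ω) k))) atTop ∂P = 0 :=
    nonpos_iff_eq_zero.1 ((lintegral_liminf_le hm).trans h1.liminf_eq.le)
  filter_upwards [(lintegral_eq_zero_iff (Measurable.liminf hm)).1 h2, ae_wait_pos hX hF]
    with ω hω hw
  have hmono := (strictMono_jumpTime (x := fun k => X k ω) hw).monotone
  refine not_explodes_of_tendsto hw ?_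
  rcases tendsto_atTop_of_monotone hmono with h | ⟨l, hl⟩
  · exact h
  · exfalso
    have h3 := (ENNReal.tendsto_ofReal ((Real.continuous_exp.tendsto _).comp hl.neg)).liminf_eq
    have h4 : ENNReal.ofReal (Real.exp (-l)) = 0 := h3.symm.trans hω
    exact absurd h4 (ENNReal.ofReal_pos.2 (Real.exp_pos _)).ne'

end Walk

end CTRW

theorem theorem1 {Ω : Type*} [MeasurableSpace Ω] (P : Measure Ω) [IsProbabilityMeasure P]
    (p q : ℕ → ℝ) (hp0 : p 0 = 1) (hpq : ∀ i, p i + q i = 1)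
    (hpos : ∀ i, 1 ≤ i → 0 < p i ∧ 0 < q i)
    (F : Bool → ℕ → Measure ℝ) [∀ s i, IsProbabilityMeasure (F s i)]
    (hF : ∀ s i, ∀ᵐ y ∂(F s i), 0 < y)
    (ρ : Measure ℕ) [IsProbabilityMeasure ρ]
    (X : ℕ → Ω → ℕ) (τ : Bool → ℕ → ℕ → Ω → ℝ)
    (hX : CTRW.IsRandomWalk P p q F ρ X τ) :
    NullMeasurableSet {ω | CTRW.Explodes (fun k => X k ω) (fun s i k => τ s i k ω)} P ∧
    (P {ω | CTRW.Explodes (fun k => X k ω) (fun s i k => τ s i k ω)} = 1 ↔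
      CTRW.explosionSeries p q F < ∞) ∧
    (P {ω | CTRW.Explodes (fun k => X k ω) (fun s i k => τ s i k ω)} = 0 ↔
      CTRW.explosionSeries p q F = ∞) := by
  by_cases hS : CTRW.explosionSeries p q F = ∞
  · have h := CTRW.ae_not_explodes hX hp0 hpq hpos hF hS
    have h0 : P {ω | CTRW.Explodes (fun k => X k ω) (fun s i k => τ s i k ω)} = 0 := by
      simpa [ae_iff] using h
    refine ⟨NullMeasurableSet.of_null h0, ?_, ?_⟩
    · simp [h0, hS]
    · simp [h0, hS]
  · have h := CTRW.ae_explodes hX hp0 hpq hpos hF hS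
    have h1 : P {ω | CTRW.Explodes (fun k => X k ω) (fun s i k => τ s i k ω)} = 1 := by
      rw [measure_congr (eventuallyEq_univ.2 h), measure_univ]
    refine ⟨nullMeasurableSet_univ.congr (eventuallyEq_univ.2 h).symm, ?_, ?_⟩
    · simp [h1, lt_top_iff_ne_top, hS]
    · simp [h1, hS]
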